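/- Let $(X,d)$ be a complete metric space and let $f:X\to X$ be continuous. **Definitions.** *Chaos.* Let $(Y,\rho)$ be a metric space and let $g:Y\to Y$ be a map. For $\varepsilon>0$, a set $S\subset Y$ is Li–Yorke $\varepsilon$-scrambled for $g$ and $\rho$ if $\limsup_{n\to\infty}\rho(g^n(x),g^n(y))\ge\varepsilon$ (the value $+\infty$ is allowed) and $\liminf_{n\to\infty}\rho(g^n(x),g^n(y))=0$ for all distinct $x,y\in S$. The system $(Y,g)$ is *Cantor-densely Li–Yorke chaotic* (CD-LYC) for $\rho$ if there is $\varepsilon>0$ such that for every sequence $(U_j)_{j\in\mathbb N}$ of non-empty open subsets of $Y$ there are sets $K_j\subset U_j$ ($j\in\mathbb N$), each homeomorphic to the ternary Cantor set, for which $\bigcup_{j\in\mathbb N} K_j$ is Li–Yorke $\varepsilon$-scrambled for $g$ and $\rho$. *Hyperspace.* $\mathcal K(X)$ is the set of non-empty compact subsets of $X$, with the Hausdorff metric $d_H$, and $\overline f(K):=f(K)$. *Fuzzy sets.* For $u:X\to[0,1]$ put $u_\alpha:=\{x : u(x)\ge\alpha\}$ for $\alpha\in(0,1]$ and $u_0:=\overline{\{x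 : u(x)>0\}}$. $\mathcal F(X)$ is the set of upper semicontinuous $u:X\to[0,1]$ with $u_0$ compact and $u_1\neq\varnothing$. The Zadeh extension $\hat f:\mathcal F(X)\to\mathcal F(X)$ is $[\hat f(u)](x):=\sup\{u(y) : f(y)=x\}$, with $\sup\varnothing:=0$. Consider the following metrics on $\mathcal F(X)$: - the supremum metric $d_\infty(u,v):=\sup_{\alpha\in[0,1]}d_H(u_\alpha,v_\alpha)$; - the Skorokhod metric $d_0(u,v)$, the infimum of the $\varepsilon>0$ for which there is a strictly increasing homeomorphism $\xi:[0,1]\to[0,1]$ with $\sup_{\alpha\in[0,1]}|\xi(\alpha)-\alpha|\le\varepsilon$ and $d_\infty(u,\xi\circ v)\le\varepsilon$; - the sendograph metric $d_S(u,v)$, the Hausdorff distance between $\operatorname{send}(u)$ and $\operatorname{send}(v)$, where $\operatorname{send}(u):=\{(x,\alpha)\in u_0\times[0,1] : u(x)\ge\alpha\}$ and $X\times[0,1]$ carries the metric $\max\{d(x,y),|\alpha-\beta|\}$. Write $\mathcal F_\infty(X)$, $\mathcal F_0(X)$, $\mathcal F_S(X)$ for $\mathcal F(X)$ with the metric $d_\infty$,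 $d_0$, $d_S$, respectively. **Theorem.** If at least one of the systems $(\mathcal F_\infty(X),\hat f)$, $(\mathcal F_0(X),\hat f)$, $(\mathcal F_S(X),\hat f)$ is CD-LYC (for its own metric), then $(\mathcal K(X),\overline f)$ is CD-LYC for the Hausdorff metric $d_H$. -/

import Mathlib

noncomputable section

/-! ## Li-Yorke pairs and Cantor-dense Li-Yorke chaos on a metric space -/

section Dynamics

variable {Y : Type*} [MetricSpace Y]

/-- `(x, y)` is a Li-Yorke `ε`-pair for `g`. The upper and lower limits are taken in the extended
reals, because the distances along the orbits may be unbounded. -/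
def IsLiYorkePair (g : Y → Y) (ε : ℝ) (x y : Y) : Prop :=
  (ε : EReal) ≤ Filter.limsup (fun n : ℕ => ((dist (g^[n] x) (g^[n] y) : ℝ) : EReal)) Filter.atTop ∧
  Filter.liminf (fun n : ℕ => ((dist (g^[n] x) (g^[n] y) : ℝ) : EReal)) Filter.atTop = 0

/-- `S` is a Li-Yorke `ε`-scrambled set for `g`. -/
def IsLiYorkeScrambled (g : Y → Y) (ε : ℝ) (S : Set Y) : Prop :=
  ∀ x ∈ S, ∀ y ∈ S, x ≠ y → IsLiYorkePair g ε x y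

/-- A Cantor set: a set homeomorphic to the classical ternary Cantor set. -/
def IsCantorSet (K : Set Y) : Prop :=
  Nonempty (K ≃ₜ cantorSet)

/-- `(Y, g)` is Cantor-densely Li-Yorke chaotic (CD-LYC) for the metric of `Y`. -/
def CantorDenselyLiYorkeChaotic (g : Y → Y) : Prop :=
  ∃ ε : ℝ, 0 < ε ∧
    ∀ U : ℕ → Set Y, (∀ j, IsOpen (U j) ∧ (U j).Nonempty) →
      ∃ K : ℕ → Set Y, (∀ j, IsCantorSet (K j)) ∧ (∀ j, K j ⊆ U j) ∧
        IsLiYorkeScrambled g ε (⋃ j, K j)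

end Dynamics

/-! ## Normal fuzzy sets -/

/-- The `α`-level of a fuzzy set `u : X → [0,1]`: the set `{u ≥ α}` if `α > 0`, and the closure of
`{u > 0}` if `α = 0`. -/
def fuzzyLevel {X : Type*} [MetricSpace X] (u : X → unitInterval) (α : unitInterval) : Set X :=
  if α = 0 then closure {x | 0 < u x} else {x | α ≤ u x}

/-- The space of normal fuzzy sets: upper semicontinuous functions `u : X → [0,1]` with compact
`0`-level and non-empty `1`-level. -/
structure NormalFuzzySet (X : Type*) [MetricSpace X] where
  toFun : X → unitInterval
  upperSemicontinuous : UpperSemicontinuous toFun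
  isCompact_level_zero : IsCompact (fuzzyLevel toFun 0)
  nonempty_level_one : (fuzzyLevel toFun 1).Nonempty

namespace NormalFuzzySet

/-- The Zadeh extension on functions: `x ↦ sup {u y ; f y = x}`, the supremum being taken in the
complete lattice `[0,1]`; it is `0` when the fibre over `x` is empty
(see `zadehFun_of_fibre_empty`). -/
def zadehFun {Z : Type*} (f : Z → Z) (u : Z → unitInterval) (x : Z) : unitInterval :=
  sSup (u '' (f ⁻¹' {x}))

theorem zadehFun_of_fibre_empty {Z : Type*} (f : Z → Z) (u : Z → unitInterval) (x : Z)
    (h : f ⁻¹' {x} = ∅) : zadehFun f u x = 0 := by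
  rw [zadehFun, h, Set.image_empty, sSup_empty]; rfl

variable {X : Type*} [MetricSpace X]

theorem ext_toFun {u v : NormalFuzzySet X} (h : ∀ x, u.toFun x = v.toFun x) : u = v := by
  cases u; cases v; congr; exact funext h

theorem isCompact_level (u : NormalFuzzySet X) (α : unitInterval) :
    IsCompact (fuzzyLevel u.toFun α) := by
  by_cases h : α = 0
  · subst h; exact u.isCompact_level_zero
  · refine u.isCompact_level_zero.of_isClosed_subset ?_ ?_
    · simp only [fuzzyLevel, if_neg h]
      exact u.upperSemicontinuous.isClosed_preimage α
    · simp only [fuzzyLevel, if_neg h, if_true]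
      intro x hx
      exact subset_closure (lt_of_lt_of_le (unitInterval.pos_iff_ne_zero.2 h) hx)

theorem nonempty_level (u : NormalFuzzySet X) (α : unitInterval) :
    (fuzzyLevel u.toFun α).Nonempty := by
  obtain ⟨x, hx⟩ := u.nonempty_level_one
  have hx1 : (1 : unitInterval) ≤ u.toFun x := by simpa [fuzzyLevel] using hx
  refine ⟨x, ?_⟩
  by_cases h : α = 0
  · subst h
    simp only [fuzzyLevel, if_true]
    exact subset_closure (lt_of_lt_of_le zero_lt_one hx1)
  · simp only [fuzzyLevel, if_neg h]
    exact le_trans unitInterval.le_one' hx1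

/-- The `α`-level of a normal fuzzy set, as an element of the hyperspace of non-empty compact
sets. -/
def level (u : NormalFuzzySet X) (α : unitInterval) : TopologicalSpace.NonemptyCompacts X :=
  ⟨⟨fuzzyLevel u.toFun α, u.isCompact_level α⟩, u.nonempty_level α⟩

/-! ### The Zadeh extension -/

theorem fuzzyLevel_zadehFun (f : X → X) (hf : Continuous f) (u : NormalFuzzySet X)
    (α : unitInterval) :
    fuzzyLevel (zadehFun f u.toFun) α = f '' fuzzyLevel u.toFun α := by
  by_cases h : α = 0
  · subst h
    have h1 : {x | 0 < zadehFun f u.toFun x} = f '' {y | 0 < u.toFun y} := by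
      ext x
      simp only [Set.mem_ofPred_eq, zadehFun, lt_sSup_iff, Set.mem_image, Set.mem_preimage,
        Set.mem_singleton_iff]
      constructor
      · rintro ⟨_, ⟨y, hy, rfl⟩, h0⟩; exact ⟨y, h0, hy⟩
      · rintro ⟨y, h0, hy⟩; exact ⟨_, ⟨y, hy, rfl⟩, h0⟩
    have hc : IsCompact (closure {y | 0 < u.toFun y}) := by
      simpa [fuzzyLevel] using u.isCompact_level_zero
    simp only [fuzzyLevel, if_true]
    rw [h1]
    refine Set.Subset.antisymm ?_ (image_closure_subset_closure_image hf)
    exact closure_minimal (Set.image_mono subset_closure) (hc.image hf).isClosed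
  · simp only [fuzzyLevel, if_neg h]
    ext x
    simp only [Set.mem_ofPred_eq, Set.mem_image]
    constructor
    · intro hx
      have hpos : (0 : unitInterval) < zadehFun f u.toFun x :=
        lt_of_lt_of_le (unitInterval.pos_iff_ne_zero.2 h) hx
      obtain ⟨_, ⟨y, hy, rfl⟩, h0⟩ := lt_sSup_iff.1 hpos
      have hc : IsCompact (closure {y | 0 < u.toFun y}) := by
        simpa [fuzzyLevel] using u.isCompact_level_zero
      have hF : IsClosed (f ⁻¹' {x}) := isClosed_singleton.preimage hf
      obtain ⟨z, ⟨-, hzF⟩, hz⟩ := UpperSemicontinuousOn.exists_isMaxOn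
        (s := closure {y | 0 < u.toFun y} ∩ f ⁻¹' {x}) ⟨y, subset_closure h0, hy⟩
        (hc.inter_right hF) (u.upperSemicontinuous.upperSemicontinuousOn _)
      refine ⟨z, hx.trans (sSup_le ?_), hzF⟩
      rintro _ ⟨w, hw, rfl⟩
      by_cases hw0 : 0 < u.toFun w
      · exact hz ⟨subset_closure hw0, hw⟩
      · exact (not_lt.1 hw0).trans unitInterval.nonneg'
    · rintro ⟨y, hy, rfl⟩
      exact hy.trans (le_sSup ⟨y, rfl, rfl⟩)

/-- The Zadeh extension of a continuous map `f`, acting on normal fuzzy sets. -/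
def zadeh (f : X → X) (hf : Continuous f) (u : NormalFuzzySet X) : NormalFuzzySet X where
  toFun := zadehFun f u.toFun
  upperSemicontinuous := by
    rw [upperSemicontinuous_iff_isClosed_preimage]
    intro α
    by_cases h : α = 0
    · subst h
      have : zadehFun f u.toFun ⁻¹' Set.Ici 0 = Set.univ :=
        Set.eq_univ_of_forall fun x => unitInterval.nonneg'
      rw [this]; exact isClosed_univ
    · have h1 := fuzzyLevel_zadehFun f hf u α
      have h2 : zadehFun f u.toFun ⁻¹' Set.Ici α = fuzzyLevel (zadehFun f u.toFun) α := by
        simp only [fuzzyLevel, if_neg h]; rfl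
      rw [h2, h1]
      exact ((u.isCompact_level α).image hf).isClosed
  isCompact_level_zero := by
    rw [fuzzyLevel_zadehFun f hf]; exact (u.isCompact_level 0).image hf
  nonempty_level_one := by
    rw [fuzzyLevel_zadehFun f hf]; exact (u.nonempty_level 1).image f

/-! ### The supremum metric -/

/-- The supremum distance: the supremum over all levels of the Hausdorff distance. -/
def dSup (u v : NormalFuzzySet X) : ℝ :=
  ⨆ α : unitInterval, dist (u.level α) (v.level α)

theorem level_le_level_zero (u : NormalFuzzySet X) (α : unitInterval) :
    (u.level α : Set X) ⊆ u.level 0 := by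
  change fuzzyLevel u.toFun α ⊆ fuzzyLevel u.toFun 0
  by_cases h : α = 0
  · subst h; exact subset_rfl
  · simp only [fuzzyLevel, if_neg h, if_true]
    intro x hx
    exact subset_closure (lt_of_lt_of_le (unitInterval.pos_iff_ne_zero.2 h) hx)

theorem bddAbove_dist_level (u v : NormalFuzzySet X) :
    BddAbove (Set.range fun α : unitInterval => dist (u.level α) (v.level α)) := by
  refine ⟨Metric.diam ((u.level 0 : Set X) ∪ v.level 0), ?_⟩
  rintro _ ⟨α, rfl⟩
  have hb : Bornology.IsBounded ((u.level 0 : Set X) ∪ v.level 0) :=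
    (u.level 0).isCompact.isBounded.union (v.level 0).isCompact.isBounded
  change dist (u.level α) (v.level α) ≤ _
  rw [Metric.NonemptyCompacts.dist_eq]
  refine (Metric.hausdorffDist_le_diam (u.level α).nonempty (u.level α).isCompact.isBounded
    (v.level α).nonempty (v.level α).isCompact.isBounded).trans (Metric.diam_mono ?_ hb)
  exact Set.union_subset_union (u.level_le_level_zero α) (v.level_le_level_zero α)

theorem dist_level_le_dSup (u v : NormalFuzzySet X) (α : unitInterval) :
    dist (u.level α) (v.level α) ≤ dSup u v :=
  le_ciSup (bddAbove_dist_level u v) α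

theorem dSup_self (u : NormalFuzzySet X) : dSup u u = 0 := by simp [dSup]

theorem dSup_comm (u v : NormalFuzzySet X) : dSup u v = dSup v u := by
  simp [dSup, dist_comm]

theorem dSup_triangle (u v w : NormalFuzzySet X) : dSup u w ≤ dSup u v + dSup v w :=
  ciSup_le fun α => (dist_triangle _ (v.level α) _).trans
    (add_le_add (dist_level_le_dSup u v α) (dist_level_le_dSup v w α))

/-! ### The Skorokhod metric -/

/-- The composition `ξ ∘ v` of a normal fuzzy set with a strictly increasing homeomorphism of
`[0,1]`. -/
def comp (ξ : unitInterval ≃ₜ unitInterval) (hξ : StrictMono ξ) (v : NormalFuzzySet X) :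
    NormalFuzzySet X where
  toFun := fun x => ξ (v.toFun x)
  upperSemicontinuous :=
    ξ.continuous.comp_upperSemicontinuous v.upperSemicontinuous hξ.monotone
  isCompact_level_zero := by
    have h0 : ξ 0 = 0 := (hξ.orderIsoOfSurjective ξ ξ.surjective).map_bot
    have : {x | 0 < ξ (v.toFun x)} = {x | 0 < v.toFun x} := by
      ext x
      change 0 < ξ (v.toFun x) ↔ 0 < v.toFun x
      rw [← hξ.lt_iff_lt (a := 0) (b := v.toFun x), h0]
    have hv := v.isCompact_level_zero
    simp only [fuzzyLevel, if_true] at hv ⊢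
    rwa [this]
  nonempty_level_one := by
    have h1 : ξ 1 = 1 := (hξ.orderIsoOfSurjective ξ ξ.surjective).map_top
    obtain ⟨x, hx⟩ := v.nonempty_level_one
    simp only [fuzzyLevel, one_ne_zero, if_false, Set.mem_ofPred_eq] at hx
    refine ⟨x, ?_⟩
    simp only [fuzzyLevel, one_ne_zero, if_false, Set.mem_ofPred_eq]
    rw [← h1]; exact hξ.monotone hx

theorem level_comp (ξ : unitInterval ≃ₜ unitInterval) (hξ : StrictMono ξ) (v : NormalFuzzySet X)
    (α : unitInterval) : (comp ξ hξ v).level (ξ α) = v.level α := by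
  have h0 : ξ 0 = 0 := (hξ.orderIsoOfSurjective ξ ξ.surjective).map_bot
  apply TopologicalSpace.NonemptyCompacts.ext
  change fuzzyLevel (fun x => ξ (v.toFun x)) (ξ α) = fuzzyLevel v.toFun α
  by_cases h : α = 0
  · subst h
    rw [h0]
    simp only [fuzzyLevel, if_true]
    congr 1
    ext x
    change 0 < ξ (v.toFun x) ↔ 0 < v.toFun x
    rw [← hξ.lt_iff_lt (a := 0) (b := v.toFun x), h0]
  · have h' : ξ α ≠ 0 := fun e => h (ξ.injective (e.trans h0.symm))
    simp only [fuzzyLevel, if_neg h, if_neg h']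
    ext x
    exact hξ.le_iff_le

theorem dSup_comp_comp (ξ : unitInterval ≃ₜ unitInterval) (hξ : StrictMono ξ)
    (u v : NormalFuzzySet X) : dSup (comp ξ hξ u) (comp ξ hξ v) = dSup u v := by
  unfold dSup
  rw [← ξ.surjective.iSup_comp]
  simp only [level_comp]

/-- The admissible values `ε` in the definition of the Skorokhod distance. -/
def skorokhodSet (u v : NormalFuzzySet X) : Set ℝ :=
  {ε | 0 < ε ∧ ∃ (ξ : unitInterval ≃ₜ unitInterval) (hξ : StrictMono ξ),
    (∀ α : unitInterval, |(ξ α : ℝ) - (α : ℝ)| ≤ ε) ∧ dSup u (comp ξ hξ v) ≤ ε}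

/-- The Skorokhod distance. -/
def dSkorokhod (u v : NormalFuzzySet X) : ℝ :=
  sInf (skorokhodSet u v)

theorem bddBelow_skorokhodSet (u v : NormalFuzzySet X) : BddBelow (skorokhodSet u v) :=
  ⟨0, fun _ h => h.1.le⟩

theorem nonempty_skorokhodSet (u v : NormalFuzzySet X) : (skorokhodSet u v).Nonempty := by
  refine ⟨max 1 (dSup u v), lt_max_of_lt_left one_pos, Homeomorph.refl _, strictMono_id, ?_, ?_⟩
  · intro α; simp
  · exact le_max_right _ _

theorem skorokhodSet_symm {u v : NormalFuzzySet X} {ε : ℝ} (h : ε ∈ skorokhodSet u v) :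
    ε ∈ skorokhodSet v u := by
  obtain ⟨h0, ξ, hξ, h1, h2⟩ := h
  have hs : StrictMono ξ.symm := fun a b hab => by
    rw [← hξ.lt_iff_lt]; simpa using hab
  refine ⟨h0, ξ.symm, hs, fun α => ?_, ?_⟩
  · have := h1 (ξ.symm α)
    rw [ξ.apply_symm_apply] at this
    rwa [abs_sub_comm]
  · have e : comp ξ.symm hs (comp ξ hξ v) = v :=
      ext_toFun fun x => ξ.symm_apply_apply _
    rw [← dSup_comp_comp ξ.symm hs, e, dSup_comm] at h2
    exact h2

theorem skorokhodSet_add {u v w : NormalFuzzySet X} {ε δ : ℝ} (h : ε ∈ skorokhodSet u v)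
    (h' : δ ∈ skorokhodSet v w) : ε + δ ∈ skorokhodSet u w := by
  obtain ⟨h0, ξ, hξ, h1, h2⟩ := h
  obtain ⟨h0', η, hη, h1', h2'⟩ := h'
  refine ⟨add_pos h0 h0', η.trans ξ, hξ.comp hη, fun α => ?_, ?_⟩
  · exact (abs_sub_le _ ((η α : unitInterval) : ℝ) _).trans (add_le_add (h1 (η α)) (h1' α))
  · have e : comp (η.trans ξ) (hξ.comp hη) w = comp ξ hξ (comp η hη w) :=
      ext_toFun fun x => rfl
    rw [e]
    refine (dSup_triangle u (comp ξ hξ v) _).trans (add_le_add h2 ?_)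
    rwa [dSup_comp_comp]

theorem dSkorokhod_self (u : NormalFuzzySet X) : dSkorokhod u u = 0 := by
  refine le_antisymm (le_of_forall_pos_le_add fun ε hε => ?_)
    (le_csInf (nonempty_skorokhodSet u u) fun _ h => h.1.le)
  rw [zero_add]
  refine csInf_le (bddBelow_skorokhodSet u u) ⟨hε, Homeomorph.refl _, strictMono_id, ?_, ?_⟩
  · intro α; simpa using hε.le
  · exact (dSup_self u).le.trans hε.le

theorem dSkorokhod_comm (u v : NormalFuzzySet X) : dSkorokhod u v = dSkorokhod v u := by
  unfold dSkorokhod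
  congr 1
  ext ε
  exact ⟨skorokhodSet_symm, skorokhodSet_symm⟩

theorem dSkorokhod_triangle (u v w : NormalFuzzySet X) :
    dSkorokhod u w ≤ dSkorokhod u v + dSkorokhod v w := by
  refine le_of_forall_pos_le_add fun r hr => ?_
  obtain ⟨ε, hε, hε'⟩ := Real.lt_sInf_add_pos (nonempty_skorokhodSet u v) (half_pos hr)
  obtain ⟨δ, hδ, hδ'⟩ := Real.lt_sInf_add_pos (nonempty_skorokhodSet v w) (half_pos hr)
  have := csInf_le (bddBelow_skorokhodSet u w) (skorokhodSet_add hε hδ)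
  unfold dSkorokhod
  linarith

/-- A criterion for pointwise inequality of normal fuzzy sets. -/
theorem le_of_approx {u v : NormalFuzzySet X}
    (h : ∀ (x : X) (r : ℝ), 0 < r →
      ∃ y, dist x y < r ∧ (u.toFun x : ℝ) ≤ (v.toFun y : ℝ) + r) (x : X) :
    u.toFun x ≤ v.toFun x := by
  by_contra hlt
  rw [not_le] at hlt
  obtain ⟨c, hc1, hc2⟩ := exists_between hlt
  obtain ⟨δ, hδ, hball⟩ := Metric.eventually_nhds_iff.1 (v.upperSemicontinuous x c hc1)
  have hc2' : (c : ℝ) < u.toFun x := hc2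
  obtain ⟨y, hy, hle⟩ := h x (min δ ((u.toFun x : ℝ) - c)) (lt_min hδ (sub_pos.2 hc2'))
  have h3 : v.toFun y < c := hball (by rw [dist_comm]; exact hy.trans_le (min_le_left _ _))
  have h3' : (v.toFun y : ℝ) < c := h3
  have := min_le_right δ ((u.toFun x : ℝ) - c)
  linarith

theorem dSkorokhod_approx {u v : NormalFuzzySet X} (h : dSkorokhod u v = 0) (x : X) (r : ℝ)
    (hr : 0 < r) : ∃ y, dist x y < r ∧ (u.toFun x : ℝ) ≤ (v.toFun y : ℝ) + r := by
  by_cases hx : u.toFun x = 0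
  · exact ⟨x, by simpa using hr, by
      rw [hx]; exact add_nonneg (v.toFun x).2.1 hr.le⟩
  obtain ⟨ε, ⟨-, ξ, hξ, h1, h2⟩, hε'⟩ := Real.lt_sInf_add_pos (nonempty_skorokhodSet u v) hr
  have hs : sInf (skorokhodSet u v) = 0 := h
  rw [hs, zero_add] at hε'
  have hxl : x ∈ (u.level (u.toFun x) : Set X) := by
    change x ∈ fuzzyLevel u.toFun (u.toFun x)
    simp [fuzzyLevel, if_neg hx]
  have hd := ((dist_level_le_dSup u (comp ξ hξ v) (u.toFun x)).trans h2).trans_lt hε'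
  rw [Metric.NonemptyCompacts.dist_eq] at hd
  obtain ⟨y, hy, hxy⟩ := Metric.exists_dist_lt_of_hausdorffDist_lt hxl hd
    (Metric.hausdorffEDist_ne_top_of_nonempty_of_bounded (TopologicalSpace.NonemptyCompacts.nonempty _)
      (TopologicalSpace.NonemptyCompacts.nonempty _)
      (TopologicalSpace.NonemptyCompacts.isCompact _).isBounded
      (TopologicalSpace.NonemptyCompacts.isCompact _).isBounded)
  refine ⟨y, hxy, ?_⟩
  have hy' : y ∈ fuzzyLevel (fun x => ξ (v.toFun x)) (u.toFun x) := hy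
  simp only [fuzzyLevel, if_neg hx, Set.mem_ofPred_eq] at hy'
  have h4 : (u.toFun x : ℝ) ≤ ξ (v.toFun y) := hy'
  have h5 := (abs_le.1 (h1 (v.toFun y))).2
  linarith

theorem eq_of_dSkorokhod_eq_zero {u v : NormalFuzzySet X} (h : dSkorokhod u v = 0) : u = v :=
  ext_toFun fun x => le_antisymm (le_of_approx (dSkorokhod_approx h) x)
    (le_of_approx (dSkorokhod_approx ((dSkorokhod_comm v u).trans h)) x)

theorem eq_of_dSup_eq_zero {u v : NormalFuzzySet X} (h : dSup u v = 0) : u = v := by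
  refine eq_of_dSkorokhod_eq_zero (le_antisymm (le_of_forall_pos_le_add fun ε hε => ?_)
    (le_csInf (nonempty_skorokhodSet u v) fun _ h => h.1.le))
  rw [zero_add]
  refine csInf_le (bddBelow_skorokhodSet u v) ⟨hε, Homeomorph.refl _, strictMono_id, ?_, ?_⟩
  · intro α; simpa using hε.le
  · exact h.le.trans hε.le

/-! ### The sendograph metric -/

/-- The sendograph `{(x, α) ; α ≤ u x} ∩ (u₀ × [0,1])`. -/
def sendographSet (u : NormalFuzzySet X) : Set (X × unitInterval) :=
  {p | p.2 ≤ u.toFun p.1} ∩ (fuzzyLevel u.toFun 0 ×ˢ Set.univ)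

theorem isCompact_sendographSet (u : NormalFuzzySet X) : IsCompact u.sendographSet :=
  (u.isCompact_level_zero.prod isCompact_univ).inter_left
    u.upperSemicontinuous.IsClosed_hypograph

theorem nonempty_sendographSet (u : NormalFuzzySet X) : u.sendographSet.Nonempty := by
  obtain ⟨x, hx⟩ := u.nonempty_level 0
  exact ⟨(x, 0), unitInterval.nonneg', hx, trivial⟩

/-- The sendograph, as a non-empty compact subset of `X × [0,1]`. The metric of the product
`X × [0,1]` is the maximum metric. -/
def sendograph (u : NormalFuzzySet X) : TopologicalSpace.NonemptyCompacts (X × unitInterval) :=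
  ⟨⟨u.sendographSet, u.isCompact_sendographSet⟩, u.nonempty_sendographSet⟩

/-- The sendograph distance: the Hausdorff distance of the sendographs. -/
def dSend (u v : NormalFuzzySet X) : ℝ :=
  dist u.sendograph v.sendograph

theorem sendograph_injective :
    Function.Injective (sendograph : NormalFuzzySet X → _) := by
  have key : ∀ u v : NormalFuzzySet X, u.sendographSet = v.sendographSet →
      ∀ x, u.toFun x ≤ v.toFun x := by
    intro u v h x
    by_cases hx : u.toFun x = 0
    · rw [hx]; exact unitInterval.nonneg'
    · have : (x, u.toFun x) ∈ u.sendographSet := by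
        refine ⟨le_refl (u.toFun x), ?_, trivial⟩
        simp only [fuzzyLevel, if_true]
        exact subset_closure (unitInterval.pos_iff_ne_zero.2 hx)
      rw [h] at this
      exact this.1
  intro u v h
  have hs : u.sendographSet = v.sendographSet :=
    congrArg (fun K : TopologicalSpace.NonemptyCompacts (X × unitInterval) =>
      (K : Set (X × unitInterval))) h
  exact ext_toFun fun x => le_antisymm (key u v hs x) (key v u hs.symm x)

end NormalFuzzySet

/-! ## The metric spaces of normal fuzzy sets and the induced systems -/

/-- The normal fuzzy sets of `X` with the supremum metric. -/
def FuzzySupSpace (X : Type*) [MetricSpace X] : Type _ := NormalFuzzySet X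

/-- The normal fuzzy sets of `X` with the Skorokhod metric. -/
def FuzzySkorokhodSpace (X : Type*) [MetricSpace X] : Type _ := NormalFuzzySet X

/-- The normal fuzzy sets of `X` with the sendograph metric. -/
def FuzzySendographSpace (X : Type*) [MetricSpace X] : Type _ := NormalFuzzySet X

section Spaces

variable {X : Type*} [MetricSpace X]

instance : MetricSpace (FuzzySupSpace X) where
  dist := NormalFuzzySet.dSup (X := X)
  dist_self := NormalFuzzySet.dSup_self
  dist_comm := NormalFuzzySet.dSup_comm
  dist_triangle := NormalFuzzySet.dSup_triangle
  eq_of_dist_eq_zero := NormalFuzzySet.eq_of_dSup_eq_zero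

instance : MetricSpace (FuzzySkorokhodSpace X) where
  dist := NormalFuzzySet.dSkorokhod (X := X)
  dist_self := NormalFuzzySet.dSkorokhod_self
  dist_comm := NormalFuzzySet.dSkorokhod_comm
  dist_triangle := NormalFuzzySet.dSkorokhod_triangle
  eq_of_dist_eq_zero := NormalFuzzySet.eq_of_dSkorokhod_eq_zero

instance : MetricSpace (FuzzySendographSpace X) where
  dist := NormalFuzzySet.dSend (X := X)
  dist_self := fun _ => dist_self _
  dist_comm := fun _ _ => dist_comm _ _
  dist_triangle := fun _ _ _ => dist_triangle _ _ _
  eq_of_dist_eq_zero := fun h => NormalFuzzySet.sendograph_injective (eq_of_dist_eq_zero h)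

/-- The Zadeh extension acting on the space with the supremum metric. -/
def zadehSup (f : X → X) (hf : Continuous f) : FuzzySupSpace X → FuzzySupSpace X :=
  NormalFuzzySet.zadeh f hf

/-- The Zadeh extension acting on the space with the Skorokhod metric. -/
def zadehSkorokhod (f : X → X) (hf : Continuous f) :
    FuzzySkorokhodSpace X → FuzzySkorokhodSpace X :=
  NormalFuzzySet.zadeh f hf

/-- The Zadeh extension acting on the space with the sendograph metric. -/
def zadehSendograph (f : X → X) (hf : Continuous f) :
    FuzzySendographSpace X → FuzzySendographSpace X :=
  NormalFuzzySet.zadeh f hf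

/-- The hyperextension `K ↦ f(K)` on the non-empty compact subsets of `X`, with Mathlib's
Hausdorff metric. -/
def hyperextension (f : X → X) (hf : Continuous f) :
    TopologicalSpace.NonemptyCompacts X → TopologicalSpace.NonemptyCompacts X :=
  TopologicalSpace.NonemptyCompacts.map f hf

end Spaces

end

open Set Filter Topology

/-! ## Cantor sets avoiding countably many closed nowhere dense relations -/

section Mycielski

variable {Y : Type*}

/-! Chaos on fuzzy sets is used only through Li–Yorke `ε`-pairs with one member in each of two
prescribed open sets. Take these to be small balls about the characteristic functions of compact
sets `A` and `B`. For a pair `u`, `v` found there, the levels of `u` are close to `A` and those of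
`v` close to `B`: all levels for the supremum and Skorokhod metrics, the levels `α ≤ 1 - r` for the
sendograph metric. Taking a level commutes with the dynamics.

Proximality of `u`, `v` passes to the `0`-levels, since `u ↦ u₀` is 1-Lipschitz for all three
metrics. Separation passes to some level: if all the controlled levels were within `ε / 2` at time
`n`, the fuzzy sets would be too. The separated level depends on `n`, so no single pair of levels
need be a Li–Yorke pair. What remains is that pairs separated, and pairs proximal, at some time `≥
k` form open dense subsets of the square of the hyperspace. The hyperspace is complete, so
Mycielski's construction gives Cantor sets whose distinct points have both properties for all large
`k`.

The argument is carried by `exists_cantorSets_eventually_mem`,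
`cantorDenselyLiYorkeChaotic_of_dense`, `CantorDenselyLiYorkeChaotic.of_levels` and the level
estimates for each metric. -/

theorem exists_shrink_pairs [TopologicalSpace Y] {ι : Type*} {R : Set (Y × Y)} (hRo : IsOpen R)
    (hRd : Dense R) (T : Finset (ι × ι)) (hT : ∀ p ∈ T, p.1 ≠ p.2) (W : ι → Set Y)
    (hW : ∀ i, IsOpen (W i) ∧ (W i).Nonempty) :
    ∃ W' : ι → Set Y, (∀ i, IsOpen (W' i) ∧ (W' i).Nonempty) ∧ (∀ i, W' i ⊆ W i) ∧
      ∀ p ∈ T, W' p.1 ×ˢ W' p.2 ⊆ R := by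
  classical
  induction T using Finset.induction_on with
  | empty => exact ⟨W, hW, fun _ => subset_rfl, by simp⟩
  | insert p T hp ih =>
    obtain ⟨V, hV, hVW, hVR⟩ := ih fun q hq => hT q (Finset.mem_insert_of_mem hq)
    have hne : p.1 ≠ p.2 := hT p (Finset.mem_insert_self p T)
    -- Density puts a point of `R` in the box and openness a smaller box around it. As `p.1 ≠ p.2`,
    -- the two factors can be shrunk independently, and shrinking preserves the pairs already
    -- treated.
    obtain ⟨⟨a, b⟩, ⟨ha, hb⟩, hab⟩ := hRd.inter_open_nonempty _ ((hV p.1).1.prod (hV p.2).1)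
      ((hV p.1).2.prod (hV p.2).2)
    obtain ⟨A, B, hA, hB, haA, hbB, hAB⟩ := isOpen_prod_iff.1 hRo a b hab
    refine ⟨Function.update (Function.update V p.1 (A ∩ V p.1)) p.2 (B ∩ V p.2), ?_⟩
    set V' := Function.update (Function.update V p.1 (A ∩ V p.1)) p.2 (B ∩ V p.2)
    have h1 : V' p.1 = A ∩ V p.1 := by simp [V', Function.update_of_ne hne]
    have h2 : V' p.2 = B ∩ V p.2 := by simp [V']
    have h3 : ∀ i, i ≠ p.1 → i ≠ p.2 → V' i = V i := fun i hi hi' => by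
      simp [V', Function.update_of_ne hi, Function.update_of_ne hi']
    have hsub : ∀ i, V' i ⊆ V i := fun i => by
      by_cases hi : i = p.1
      · rw [hi, h1]; exact inter_subset_right
      by_cases hi' : i = p.2
      · rw [hi', h2]; exact inter_subset_right
      rw [h3 i hi hi']
    refine ⟨fun i => ?_, fun i => (hsub i).trans (hVW i), fun q hq => ?_⟩
    · by_cases hi : i = p.1
      · rw [hi, h1]; exact ⟨hA.inter (hV _).1, a, haA, ha⟩
      by_cases hi' : i = p.2
      · rw [hi', h2]; exact ⟨hB.inter (hV _).1, b, hbB, hb⟩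
      rw [h3 i hi hi']; exact hV i
    · rcases Finset.mem_insert.1 hq with rfl | hq
      · rw [h1, h2]
        exact (prod_mono inter_subset_left inter_subset_left).trans hAB
      · exact (prod_mono (hsub _) (hsub _)).trans (hVR q hq)

variable [MetricSpace Y]

theorem exists_closure_subset_ediam_le {W : Set Y} (hW : IsOpen W) (hne : W.Nonempty) {δ : ℝ}
    (hδ : 0 < δ) : ∃ V : Set Y, IsOpen V ∧ V.Nonempty ∧ closure V ⊆ W ∧
      Metric.ediam V ≤ ENNReal.ofReal δ := by
  obtain ⟨a, ha⟩ := hne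
  obtain ⟨r, hr, hrW⟩ := Metric.isOpen_iff.1 hW a ha
  have hs : 0 < min (r / 2) (δ / 2) := by positivity
  refine ⟨Metric.ball a (min (r / 2) (δ / 2)), Metric.isOpen_ball, ⟨a, Metric.mem_ball_self hs⟩,
    Metric.closure_ball_subset_closedBall.trans ((Metric.closedBall_subset_ball ?_).trans hrW), ?_⟩
  · exact (min_le_left _ _).trans_lt (half_lt_self hr)
  · refine Metric.ediam_le fun x hx y hy => ?_
    rw [edist_dist]
    refine ENNReal.ofReal_le_ofReal ?_
    have h1 : dist x a < δ / 2 := (Metric.mem_ball.1 hx).trans_le (min_le_right _ _)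
    have h2 : dist y a < δ / 2 := (Metric.mem_ball.1 hy).trans_le (min_le_right _ _)
    linarith [dist_triangle_right x y a]

/-- One refinement step: every set `W (j, l)` is replaced by one small set for each extension
`b :: l`, and the new sets with `j < k` of generation `k + 1` are pairwise related by `R`. -/
theorem exists_refinement {R : Set (Y × Y)} (hRo : IsOpen R) (hRd : Dense R) (k : ℕ)
    (W : ℕ × List Bool → Set Y) (hW : ∀ i, IsOpen (W i) ∧ (W i).Nonempty) :
    ∃ W' : ℕ × List Bool → Set Y, (∀ i, IsOpen (W' i) ∧ (W' i).Nonempty) ∧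
      (∀ j l b, closure (W' (j, b :: l)) ⊆ W (j, l)) ∧
      (∀ i, Metric.ediam (W' i) ≤ ENNReal.ofReal (1 / (k + 1))) ∧
      ∀ i i', i ≠ i' → i.1 < k → i'.1 < k → i.2.length = k + 1 → i'.2.length = k + 1 →
        W' i ×ˢ W' i' ⊆ R := by
  classical
  have hfin : {i : ℕ × List Bool | i.1 < k ∧ i.2.length = k + 1}.Finite :=
    (Set.finite_lt_nat k).prod (List.finite_length_eq Bool (k + 1))
  have hfin2 : {p : (ℕ × List Bool) × (ℕ × List Bool) | p.1 ≠ p.2 ∧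
      (p.1.1 < k ∧ p.1.2.length = k + 1) ∧ (p.2.1 < k ∧ p.2.2.length = k + 1)}.Finite :=
    (hfin.prod hfin).subset fun p hp => hp.2
  -- Each child starts from its parent's set, given by the tail. Siblings start from the same set;
  -- only `R` tells them apart.
  obtain ⟨V, hV, hVW, hVR⟩ := exists_shrink_pairs hRo hRd hfin2.toFinset
    (fun p hp => (hfin2.mem_toFinset.1 hp).1) (fun i => W (i.1, i.2.tail)) (fun i => hW _)
  have hδ : (0 : ℝ) < 1 / (k + 1) := by positivity
  choose V' hV'o hV'n hV'c hV'd using fun i =>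
    exists_closure_subset_ediam_le (hV i).1 (hV i).2 hδ
  refine ⟨V', fun i => ⟨hV'o i, hV'n i⟩, fun j l b => (hV'c _).trans (hVW (j, b :: l)), hV'd, ?_⟩
  intro i i' hne h1 h2 h3 h4
  have hsub : ∀ i, V' i ⊆ V i := fun i => subset_closure.trans (hV'c i)
  exact (prod_mono (hsub i) (hsub i')).trans
    (hVR (i, i') (hfin2.mem_toFinset.2 ⟨hne, ⟨h1, h3⟩, ⟨h2, h4⟩⟩))

/-- A version of Mycielski's theorem. -/
theorem exists_cantorSets_eventually_mem [CompleteSpace Y] {R : ℕ → Set (Y × Y)}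
    (hRo : ∀ k, IsOpen (R k)) (hRd : ∀ k, Dense (R k)) (hRne : ∀ k, ∀ p ∈ R k, p.1 ≠ p.2)
    (U : ℕ → Set Y) (hU : ∀ j, IsOpen (U j) ∧ (U j).Nonempty) :
    ∃ K : ℕ → Set Y, (∀ j, IsCantorSet (K j)) ∧ (∀ j, K j ⊆ U j) ∧
      ∀ x ∈ ⋃ j, K j, ∀ y ∈ ⋃ j, K j, x ≠ y → ∀ᶠ k in atTop, (x, y) ∈ R k := by
  let P := {W : ℕ × List Bool → Set Y // ∀ i, IsOpen (W i) ∧ (W i).Nonempty}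
  choose F hF1 hF2 hF3 hF4 using fun (k : ℕ) (W : P) =>
    exists_refinement (hRo k) (hRd k) k W.1 W.2
  let W : ℕ → P := fun n => Nat.rec (motive := fun _ => P) ⟨fun i => U i.1, fun i => hU i.1⟩
    (fun k V => ⟨F k V, hF1 k V⟩) n
  have hWs : ∀ k, (W (k + 1)).1 = F k (W k) := fun k => rfl
  -- Stage `n` assigns a set to every list, but only lists of length `n` matter there.
  let A : ℕ → List Bool → Set Y := fun j l => (W l.length).1 (j, l)
  have hanti : ∀ j, CantorScheme.ClosureAntitone (A j) := fun j l b => hF2 l.length _ j l b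
  have hdiam : ∀ j, CantorScheme.VanishingDiam (A j) := by
    intro j s
    rw [← tendsto_add_atTop_iff_nat 1]
    have h0 : Tendsto (fun k : ℕ => ENNReal.ofReal (1 / ((k : ℝ) + 1))) atTop (𝓝 0) := by
      rw [← ENNReal.ofReal_zero]
      exact ENNReal.tendsto_ofReal tendsto_one_div_add_atTop_nhds_zero_nat
    refine tendsto_of_tendsto_of_tendsto_of_le_of_le tendsto_const_nhds h0
      (fun _ => zero_le) fun k => ?_
    change Metric.ediam ((W (PiNat.res s (k + 1)).length).1 (j, PiNat.res s (k + 1))) ≤ _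
    rw [PiNat.res_length, hWs]
    exact hF3 k _ _
  have hne : ∀ j l, (A j l).Nonempty := fun j l => ((W l.length).2 _).2
  have hdom : ∀ j, (CantorScheme.inducedMap (A j)).1 = univ := fun j =>
    (hanti j).map_of_vanishingDiam (hdiam j) (hne j)
  have hdom' : ∀ j s, s ∈ (CantorScheme.inducedMap (A j)).1 := fun j s => by
    rw [hdom j]; trivial
  let φ : ℕ → (ℕ → Bool) → Y := fun j s => (CantorScheme.inducedMap (A j)).2 ⟨s, hdom' j s⟩
  have hφc : ∀ j, Continuous (φ j) := fun j =>
    (hdiam j).map_continuous.comp (continuous_id.subtype_mk _)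
  have hφm : ∀ j s n, φ j s ∈ A j (PiNat.res s n) := fun j s n =>
    CantorScheme.map_mem (A := A j) ⟨s, hdom' j s⟩ n
  have hφR : ∀ j s j' s', (j, s) ≠ (j', s') → ∀ᶠ k in atTop, (φ j s, φ j' s') ∈ R k := by
    intro j s j' s' h
    have hev : ∀ᶠ k in atTop, (j, PiNat.res s (k + 1)) ≠ (j', PiNat.res s' (k + 1)) := by
      by_cases hj : j = j'
      · have hs : s ≠ s' := fun e => h (by rw [hj, e])
        obtain ⟨n, hn⟩ := Function.ne_iff.1 hs
        filter_upwards [eventually_ge_atTop n] with k hk e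
        exact hn (PiNat.res_eq_res.1 (Prod.ext_iff.1 e).2 (Nat.lt_succ_of_le hk))
      · exact Eventually.of_forall fun k e => hj (Prod.ext_iff.1 e).1
    -- Stage `k` relates only the finitely many sets of generation `k + 1` with indices below `k`,
    -- so two given branches are related only from some `k` on.
    filter_upwards [hev, eventually_gt_atTop j, eventually_gt_atTop j'] with k hk h1 h2
    have m1 := hφm j s (k + 1)
    have m2 := hφm j' s' (k + 1)
    simp only [A, PiNat.res_length, hWs] at m1 m2
    exact hF4 k (W k) _ _ hk h1 h2 (PiNat.res_length _ _) (PiNat.res_length _ _) ⟨m1, m2⟩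
  have hφi : ∀ j, Function.Injective (φ j) := by
    intro j s s' e
    by_contra h
    -- Disjointness is not built into the scheme: injectivity holds because `R k` misses the
    -- diagonal.
    obtain ⟨k, hk⟩ := (hφR j s j s' fun e => h (Prod.ext_iff.1 e).2).exists
    exact hRne k _ hk e
  refine ⟨fun j => range (φ j), fun j => ?_, fun j => ?_, ?_⟩
  · exact ⟨((hφc j).isClosedEmbedding (hφi j)).isEmbedding.toHomeomorph.symm.trans
      cantorSetHomeomorphNatToBool.symm⟩
  · rintro _ ⟨s, rfl⟩
    exact hφm j s 0
  · intro x hx y hy hxy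
    obtain ⟨j, s, rfl⟩ := mem_iUnion.1 hx
    obtain ⟨j', s', rfl⟩ := mem_iUnion.1 hy
    refine hφR j s j' s' fun e => hxy ?_
    obtain ⟨rfl, rfl⟩ := Prod.ext_iff.1 e
    rfl

end Mycielski

/-! ## Chaos from density of proximal and of separated pairs -/

section Chaos

variable {Y : Type*} [MetricSpace Y]

theorem IsLiYorkePair.frequently_lt_dist {g : Y → Y} {ε δ : ℝ} {x y : Y}
    (h : IsLiYorkePair g ε x y) (hδ : δ < ε) :
    ∃ᶠ n in atTop, δ < dist (g^[n] x) (g^[n] y) := by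
  have h1 : (δ : EReal) < limsup (fun n : ℕ => ((dist (g^[n] x) (g^[n] y) : ℝ) : EReal)) atTop :=
    (EReal.coe_lt_coe_iff.2 hδ).trans_le h.1
  exact (frequently_lt_of_lt_limsup (by isBoundedDefault) h1).mono fun n hn =>
    EReal.coe_lt_coe_iff.1 hn

theorem IsLiYorkePair.frequently_dist_lt {g : Y → Y} {ε δ : ℝ} {x y : Y}
    (h : IsLiYorkePair g ε x y) (hδ : 0 < δ) :
    ∃ᶠ n in atTop, dist (g^[n] x) (g^[n] y) < δ := by
  have h1 : liminf (fun n : ℕ => ((dist (g^[n] x) (g^[n] y) : ℝ) : EReal)) atTop < (δ : EReal) := by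
    rw [h.2]; exact EReal.coe_pos.2 hδ
  exact (frequently_lt_of_liminf_lt (by isBoundedDefault) h1).mono fun n hn =>
    EReal.coe_lt_coe_iff.1 hn

theorem isLiYorkePair_of_frequently {g : Y → Y} {ε : ℝ} {x y : Y}
    (hsep : ∃ᶠ n in atTop, ε ≤ dist (g^[n] x) (g^[n] y))
    (hprox : ∀ δ > 0, ∃ᶠ n in atTop, dist (g^[n] x) (g^[n] y) ≤ δ) : IsLiYorkePair g ε x y := by
  refine ⟨le_limsup_of_frequently_le' (hsep.mono fun n hn => EReal.coe_le_coe_iff.2 hn),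
    le_antisymm ?_ ?_⟩
  · refine EReal.le_of_forall_lt_iff_le.1 fun δ hδ => ?_
    exact liminf_le_of_frequently_le' ((hprox δ (EReal.coe_pos.1 hδ)).mono fun n hn =>
      EReal.coe_le_coe_iff.2 hn)
  · exact le_liminf_of_le (by isBoundedDefault)
      (Eventually.of_forall fun n => EReal.coe_nonneg.2 dist_nonneg)

/-- The two hypotheses may be witnessed by different pairs: each makes one family of open sets
dense, and finite intersections of open dense sets are dense. Membership for all large `k` suffices,
as the times involved are at least `k`. -/
theorem cantorDenselyLiYorkeChaotic_of_dense [CompleteSpace Y] {g : Y → Y} (hg : Continuous g)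
    {c : ℝ} (hc : 0 < c)
    (hsep : ∀ U V : Set Y, IsOpen U → IsOpen V → U.Nonempty → V.Nonempty → ∀ N : ℕ,
      ∃ a ∈ U, ∃ b ∈ V, ∃ n ≥ N, c < dist (g^[n] a) (g^[n] b))
    (hprox : ∀ U V : Set Y, IsOpen U → IsOpen V → U.Nonempty → V.Nonempty → ∀ N : ℕ, ∀ δ > 0,
      ∃ a ∈ U, ∃ b ∈ V, ∃ n ≥ N, dist (g^[n] a) (g^[n] b) < δ) :
    CantorDenselyLiYorkeChaotic g := by
  have hcont : ∀ n, Continuous fun p : Y × Y => dist (g^[n] p.1) (g^[n] p.2) := fun n =>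
    ((hg.iterate n).comp continuous_fst).dist ((hg.iterate n).comp continuous_snd)
  let S : ℕ → Set (Y × Y) := fun k => {p | ∃ n ≥ k, c < dist (g^[n] p.1) (g^[n] p.2)}
  let T : ℕ → Set (Y × Y) := fun k =>
    {p | ∃ n ≥ k, dist (g^[n] p.1) (g^[n] p.2) < 1 / ((k : ℝ) + 1)}
  have hSo : ∀ k, IsOpen (S k) := fun k => by
    have : S k = ⋃ n ≥ k, {p | c < dist (g^[n] p.1) (g^[n] p.2)} := by ext; simp [S]
    rw [this]
    exact isOpen_biUnion fun n _ => isOpen_lt continuous_const (hcont n)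
  have hTo : ∀ k, IsOpen (T k) := fun k => by
    have : T k = ⋃ n ≥ k, {p | dist (g^[n] p.1) (g^[n] p.2) < 1 / ((k : ℝ) + 1)} := by
      ext; simp [T]
    rw [this]
    exact isOpen_biUnion fun n _ => isOpen_lt (hcont n) continuous_const
  have hdense : ∀ D : Set (Y × Y), (∀ U V : Set Y, IsOpen U → IsOpen V → U.Nonempty → V.Nonempty →
      ∃ a ∈ U, ∃ b ∈ V, (a, b) ∈ D) → Dense D := by
    intro D h
    refine dense_iff_inter_open.2 fun O hO ⟨⟨x, y⟩, hxy⟩ => ?_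
    obtain ⟨U, V, hU, hV, hx, hy, hUV⟩ := isOpen_prod_iff.1 hO x y hxy
    obtain ⟨a, ha, b, hb, hab⟩ := h U V hU hV ⟨x, hx⟩ ⟨y, hy⟩
    exact ⟨(a, b), hUV ⟨ha, hb⟩, hab⟩
  have hSd : ∀ k, Dense (S k) := fun k => hdense _ fun U V hU hV hU' hV' =>
    hsep U V hU hV hU' hV' k
  have hTd : ∀ k, Dense (T k) := fun k => hdense _ fun U V hU hV hU' hV' =>
    hprox U V hU hV hU' hV' k _ (by positivity)
  refine ⟨c, hc, fun U hU => ?_⟩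
  obtain ⟨K, hK, hKU, hKR⟩ := exists_cantorSets_eventually_mem (R := fun k => S k ∩ T k)
    (fun k => (hSo k).inter (hTo k)) (fun k => (hSd k).inter_of_isOpen_left (hTd k) (hSo k))
    (by
      rintro k ⟨x, y⟩ ⟨⟨n, -, hn⟩, -⟩ (rfl : x = y)
      rw [dist_self] at hn
      exact hc.not_gt hn) U hU
  refine ⟨K, hK, hKU, fun x hx y hy hxy => ?_⟩
  have hev := hKR x hx y hy hxy
  refine isLiYorkePair_of_frequently (frequently_atTop.2 fun N => ?_) fun δ hδ =>
    frequently_atTop.2 fun N => ?_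
  · obtain ⟨k, ⟨⟨n, hn, hn'⟩, -⟩, hk⟩ := (hev.and (eventually_ge_atTop N)).exists
    exact ⟨n, hk.trans hn, hn'.le⟩
  · have hsmall : ∀ᶠ k : ℕ in atTop, 1 / ((k : ℝ) + 1) < δ :=
      (tendsto_order.1 tendsto_one_div_add_atTop_nhds_zero_nat).2 δ hδ
    obtain ⟨k, ⟨⟨-, n, hn, hn'⟩, hk⟩, hkδ⟩ :=
      ((hev.and (eventually_ge_atTop N)).and hsmall).exists
    exact ⟨n, hk.trans hn, (hn'.trans hkδ).le⟩

theorem IsCantorSet.infinite {K : Set Y} (hK : IsCantorSet K) : K.Infinite := by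
  obtain ⟨e⟩ := hK
  have : Infinite K := Infinite.of_injective (fun s => (e.trans cantorSetHomeomorphNatToBool).symm s)
    (Homeomorph.injective _)
  exact Set.infinite_coe_iff.1 this

theorem CantorDenselyLiYorkeChaotic.exists_isLiYorkePair {g : Y → Y}
    (h : CantorDenselyLiYorkeChaotic g) : ∃ ε > 0, ∀ U V : Set Y, IsOpen U → IsOpen V →
      U.Nonempty → V.Nonempty → ∃ x ∈ U, ∃ y ∈ V, IsLiYorkePair g ε x y := by
  obtain ⟨ε, hε, h⟩ := h
  refine ⟨ε, hε, fun U V hU hV hU' hV' => ?_⟩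
  obtain ⟨K, hK, hKU, hS⟩ := h (fun j => if j = 0 then U else V) fun j => by
    by_cases hj : j = 0
    · simpa [hj] using ⟨hU, hU'⟩
    · simpa [hj] using ⟨hV, hV'⟩
  obtain ⟨x, hx⟩ := (hK 0).infinite.nonempty
  -- The two Cantor sets may overlap, so a point other than `x` is chosen.
  obtain ⟨y, hy, hyx⟩ := (hK 1).infinite.exists_notMem_finite (Set.finite_singleton x)
  exact ⟨x, by simpa using hKU 0 hx, y, by simpa using hKU 1 hy,
    hS x (mem_iUnion.2 ⟨0, hx⟩) y (mem_iUnion.2 ⟨1, hy⟩) fun e => hyx e.symm⟩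

/-- Transfer of chaos along a family of semiconjugacies `L · α` that all approximately invert
`χ`, one of them being a contraction, and that together control the distance. -/
theorem CantorDenselyLiYorkeChaotic.of_levels [CompleteSpace Y] {Z I : Type*} [MetricSpace Z]
    {g : Y → Y} (hg : Continuous g) {G : Z → Z} (hG : CantorDenselyLiYorkeChaotic G)
    (χ : Y → Z) (L : Z → I → Y) (α₀ : I)
    (hLG : ∀ u α, L (G u) α = g (L u α))
    (hbase : ∀ u v, dist (L u α₀) (L v α₀) ≤ dist u v)
    (hlev : ∀ r : ℝ, 0 < r → r ≤ 1 → ∃ S : Set I, α₀ ∈ S ∧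
      (∀ u a, dist u (χ a) < r → ∀ α ∈ S, dist (L u α) a < r) ∧
      ∀ u v c, r ≤ c → (∀ α ∈ S, dist (L u α) (L v α) ≤ c) → dist u v ≤ c) :
    CantorDenselyLiYorkeChaotic g := by
  obtain ⟨ε, hε, hpair⟩ := hG.exists_isLiYorkePair
  have hiter : ∀ n u α, L (G^[n] u) α = g^[n] (L u α) := fun n u α =>
    Function.Semiconj.iterate_right (f := fun u => L u α) (fun u => hLG u α) n u
  have key : ∀ U V : Set Y, IsOpen U → IsOpen V → U.Nonempty → V.Nonempty →
      ∃ S : Set I, α₀ ∈ S ∧ ∃ u v, IsLiYorkePair G ε u v ∧ (∀ α ∈ S, L u α ∈ U ∧ L v α ∈ V) ∧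
        ∀ u v, (∀ α ∈ S, dist (L u α) (L v α) ≤ ε / 2) → dist u v ≤ ε / 2 := by
    rintro U V hU hV ⟨a, ha⟩ ⟨b, hb⟩
    obtain ⟨r, hr, hrU⟩ := Metric.isOpen_iff.1 hU a ha
    obtain ⟨s, hs, hsV⟩ := Metric.isOpen_iff.1 hV b hb
    -- The bounds `t ≤ 1` and `t ≤ ε / 2` make `hlev` applicable with radius `t` and threshold `ε /
    -- 2`.
    obtain ⟨t, ht, htr, hts, ht1, htε⟩ : ∃ t > 0, t ≤ r ∧ t ≤ s ∧ t ≤ 1 ∧ t ≤ ε / 2 :=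
      ⟨min (min r s) (min 1 (ε / 2)), by positivity, by simp, by simp, by simp, by simp⟩
    obtain ⟨S, h0, h1, h2⟩ := hlev t ht ht1
    obtain ⟨u, hu, v, hv, huv⟩ := hpair (Metric.ball (χ a) t) (Metric.ball (χ b) t)
      Metric.isOpen_ball Metric.isOpen_ball ⟨_, Metric.mem_ball_self ht⟩
      ⟨_, Metric.mem_ball_self ht⟩
    exact ⟨S, h0, u, v, huv, fun α hα => ⟨hrU ((h1 u a hu α hα).trans_le htr),
      hsV ((h1 v b hv α hα).trans_le hts)⟩, fun u v => h2 u v _ htε⟩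
  refine cantorDenselyLiYorkeChaotic_of_dense hg (half_pos hε) ?_ ?_
  · intro U V hU hV hU' hV' N
    obtain ⟨S, -, u, v, huv, hmem, hdist⟩ := key U V hU hV hU' hV'
    obtain ⟨n, hn, hlt⟩ := frequently_atTop.1 (huv.frequently_lt_dist (half_lt_self hε)) N
    -- Otherwise all levels in `S` would be within `ε / 2` at time `n`, forcing the same bound on
    -- the iterates of `u` and `v`.
    by_contra! hcon
    refine hlt.not_ge (hdist _ _ fun α hα => ?_)
    rw [hiter, hiter]
    exact hcon _ (hmem α hα).1 _ (hmem α hα).2 n hn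
  · intro U V hU hV hU' hV' N δ hδ
    obtain ⟨S, h0, u, v, huv, hmem, -⟩ := key U V hU hV hU' hV'
    obtain ⟨n, hn, hlt⟩ := frequently_atTop.1 (huv.frequently_dist_lt hδ) N
    refine ⟨_, (hmem α₀ h0).1, _, (hmem α₀ h0).2, n, hn, ?_⟩
    rw [← hiter, ← hiter]
    exact (hbase _ _).trans_lt hlt

end Chaos

/-! ## Levels of fuzzy sets and the three metrics -/

section Fuzzy

variable {X : Type*} [MetricSpace X]

/-- Compactness makes the distance to a set attained, so non-strict bounds can be tested on points.
-/
theorem TopologicalSpace.NonemptyCompacts.dist_le_iff {K L : TopologicalSpace.NonemptyCompacts X}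
    {r : ℝ} : dist K L ≤ r ↔ (∀ x ∈ K, ∃ y ∈ L, dist x y ≤ r) ∧ ∀ y ∈ L, ∃ x ∈ K, dist x y ≤ r := by
  have half : ∀ K L : TopologicalSpace.NonemptyCompacts X, ∀ x ∈ K, ∃ y ∈ L,
      dist x y ≤ dist K L := by
    intro K L x hx
    obtain ⟨y, hy, hxy⟩ := L.isCompact.exists_infDist_eq_dist L.nonempty x
    refine ⟨y, hy, hxy ▸ ?_⟩
    rw [Metric.NonemptyCompacts.dist_eq]
    exact Metric.infDist_le_hausdorffDist_of_mem hx
      (Metric.hausdorffEDist_ne_top_of_nonempty_of_bounded K.nonempty L.nonempty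
        K.isCompact.isBounded L.isCompact.isBounded)
  constructor
  · refine fun h => ⟨fun x hx => ?_, fun y hy => ?_⟩
    · obtain ⟨y, hy, hxy⟩ := half K L x hx
      exact ⟨y, hy, hxy.trans h⟩
    · obtain ⟨x, hx, hxy⟩ := half L K y hy
      exact ⟨x, hx, by rw [dist_comm]; exact hxy.trans (dist_comm L K ▸ h)⟩
  · rintro ⟨h1, h2⟩
    obtain ⟨x, hx⟩ := K.nonempty
    obtain ⟨y, -, hxy⟩ := h1 x hx
    rw [Metric.NonemptyCompacts.dist_eq]
    refine Metric.hausdorffDist_le_of_mem_dist (dist_nonneg.trans hxy) h1 fun y hy => ?_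
    obtain ⟨x, hx, hxy⟩ := h2 y hy
    exact ⟨x, hx, by rwa [dist_comm]⟩

namespace NormalFuzzySet

/-- Levels are the horizontal slices of the sendograph, including height `0`, where the factor `u₀`
does the work. -/
theorem mem_level_iff_mem_sendograph (u : NormalFuzzySet X) (x : X) (α : unitInterval) :
    x ∈ u.level α ↔ (x, α) ∈ u.sendograph := by
  change x ∈ fuzzyLevel u.toFun α ↔ α ≤ u.toFun x ∧ x ∈ fuzzyLevel u.toFun 0 ∧ True
  constructor
  · intro hx
    refine ⟨?_, u.level_le_level_zero α hx, trivial⟩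
    by_cases h : α = 0
    · rw [h]; exact unitInterval.nonneg'
    · simp only [fuzzyLevel, if_neg h] at hx; exact hx
  · rintro ⟨h1, h2, -⟩
    by_cases h : α = 0
    · rwa [h]
    · simp only [fuzzyLevel, if_neg h]; exact h1

theorem level_anti (u : NormalFuzzySet X) {α β : unitInterval} (h : α ≤ β) {x : X}
    (hx : x ∈ u.level β) : x ∈ u.level α := by
  rw [mem_level_iff_mem_sendograph] at hx ⊢
  exact ⟨h.trans hx.1, hx.2⟩

theorem level_zadeh (f : X → X) (hf : Continuous f) (u : NormalFuzzySet X) (α : unitInterval) :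
    (zadeh f hf u).level α = hyperextension f hf (u.level α) :=
  TopologicalSpace.NonemptyCompacts.ext (fuzzyLevel_zadehFun f hf u α)

/-! ### Characteristic functions of compact sets -/

theorem fuzzyLevel_indicator (K : TopologicalSpace.NonemptyCompacts X) (α : unitInterval) :
    fuzzyLevel ((K : Set X).indicator fun _ => (1 : unitInterval)) α = K := by
  by_cases h : α = 0
  · have : {x | 0 < (K : Set X).indicator (fun _ => (1 : unitInterval)) x} = K := by
      ext x
      change 0 < (K : Set X).indicator (fun _ => (1 : unitInterval)) x ↔ x ∈ (K : Set X)
      by_cases hx : x ∈ (K : Set X)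
      · rw [indicator_of_mem hx]; exact iff_of_true zero_lt_one hx
      · rw [indicator_of_notMem hx]; exact iff_of_false (lt_irrefl _) hx
    simp only [fuzzyLevel, if_pos h, this]
    exact K.isCompact.isClosed.closure_eq
  · simp only [fuzzyLevel, if_neg h]
    ext x
    change α ≤ (K : Set X).indicator (fun _ => (1 : unitInterval)) x ↔ x ∈ (K : Set X)
    by_cases hx : x ∈ (K : Set X)
    · rw [indicator_of_mem hx]; exact iff_of_true unitInterval.le_one' hx
    · rw [indicator_of_notMem hx]
      exact iff_of_false (unitInterval.pos_iff_ne_zero.2 h).not_ge hx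

/-- The characteristic function of a non-empty compact set. -/
noncomputable def ofCompacts (K : TopologicalSpace.NonemptyCompacts X) : NormalFuzzySet X where
  toFun := (K : Set X).indicator fun _ => 1
  upperSemicontinuous := K.isCompact.isClosed.upperSemicontinuous_indicator unitInterval.nonneg'
  isCompact_level_zero := by rw [fuzzyLevel_indicator]; exact K.isCompact
  nonempty_level_one := by rw [fuzzyLevel_indicator]; exact K.nonempty

theorem level_ofCompacts (K : TopologicalSpace.NonemptyCompacts X) (α : unitInterval) :
    (ofCompacts K).level α = K :=
  TopologicalSpace.NonemptyCompacts.ext (fuzzyLevel_indicator K α)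

/-- Only the values `0` and `1` occur and `ξ` fixes both, so Skorokhod balls about characteristic
functions give the same level control as supremum balls. -/
theorem comp_ofCompacts (ξ : unitInterval ≃ₜ unitInterval) (hξ : StrictMono ξ)
    (K : TopologicalSpace.NonemptyCompacts X) : comp ξ hξ (ofCompacts K) = ofCompacts K := by
  classical
  have h0 : ξ 0 = 0 := (hξ.orderIsoOfSurjective ξ ξ.surjective).map_bot
  have h1 : ξ 1 = 1 := (hξ.orderIsoOfSurjective ξ ξ.surjective).map_top
  refine ext_toFun fun x => ?_
  change ξ ((K : Set X).indicator (fun _ => 1) x) = (K : Set X).indicator (fun _ => 1) x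
  by_cases hx : x ∈ (K : Set X) <;> simp [Set.indicator, hx, h0, h1]

/-! ### Level estimates for the three metrics -/

theorem dist_level_lt_of_dSup_lt {u : NormalFuzzySet X} {K : TopologicalSpace.NonemptyCompacts X}
    {r : ℝ} (h : dSup u (ofCompacts K) < r) (α : unitInterval) : dist (u.level α) K < r := by
  have := dist_level_le_dSup u (ofCompacts K) α
  rw [level_ofCompacts] at this
  exact this.trans_lt h

theorem dist_level_lt_of_dSkorokhod_lt {u : NormalFuzzySet X}
    {K : TopologicalSpace.NonemptyCompacts X} {r : ℝ} (h : dSkorokhod u (ofCompacts K) < r)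
    (α : unitInterval) : dist (u.level α) K < r := by
  obtain ⟨ε, ⟨-, ξ, hξ, -, h2⟩, hε⟩ := exists_lt_of_csInf_lt (nonempty_skorokhodSet _ _) h
  rw [comp_ofCompacts] at h2
  exact dist_level_lt_of_dSup_lt (h2.trans_lt hε) α

theorem dSkorokhod_le_of_dSup_le {u v : NormalFuzzySet X} {c : ℝ} (hc : 0 < c)
    (h : dSup u v ≤ c) : dSkorokhod u v ≤ c :=
  csInf_le (bddBelow_skorokhodSet u v)
    ⟨hc, Homeomorph.refl _, strictMono_id, fun α => by simpa using hc.le, h⟩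

/-- Reparametrisations fix `0`, so they leave the `0`-level in place; this is why `0` serves as the
base level. -/
theorem dist_level_zero_le_dSkorokhod (u v : NormalFuzzySet X) :
    dist (u.level 0) (v.level 0) ≤ dSkorokhod u v := by
  refine le_csInf (nonempty_skorokhodSet u v) ?_
  rintro ε ⟨-, ξ, hξ, -, h2⟩
  have h0 : ξ 0 = 0 := (hξ.orderIsoOfSurjective ξ ξ.surjective).map_bot
  have h3 := level_comp ξ hξ v 0
  rw [h0] at h3
  rw [← h3]
  exact (dist_level_le_dSup u _ 0).trans h2

theorem dist_level_zero_le_dSend (u v : NormalFuzzySet X) :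
    dist (u.level 0) (v.level 0) ≤ dSend u v := by
  obtain ⟨h1, h2⟩ := TopologicalSpace.NonemptyCompacts.dist_le_iff.1 (le_refl (dSend u v))
  refine TopologicalSpace.NonemptyCompacts.dist_le_iff.2 ⟨fun x hx => ?_, fun y hy => ?_⟩
  · obtain ⟨⟨y, β⟩, hy, hxy⟩ := h1 (x, 0) ((mem_level_iff_mem_sendograph u x 0).1 hx)
    exact ⟨y, v.level_anti unitInterval.nonneg' ((mem_level_iff_mem_sendograph v y β).2 hy),
      (le_max_left _ _).trans hxy⟩
  · obtain ⟨⟨x, β⟩, hx, hxy⟩ := h2 (y, 0) ((mem_level_iff_mem_sendograph v y 0).1 hy)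
    exact ⟨x, u.level_anti unitInterval.nonneg' ((mem_level_iff_mem_sendograph u x β).2 hx),
      (le_max_left _ _).trans hxy⟩

/-- A point `(y, 1)` over `K` is matched at a height at least `1 - r ≥ α`, hence inside the
`α`-level. The other direction uses that this level lies in the `0`-level. -/
theorem dist_level_lt_of_dSend_lt {u : NormalFuzzySet X} {K : TopologicalSpace.NonemptyCompacts X}
    {r : ℝ} (h : dSend u (ofCompacts K) < r) {α : unitInterval} (hα : (α : ℝ) ≤ 1 - r) :
    dist (u.level α) K < r := by
  refine lt_of_le_of_lt ?_ h
  have h0 := dist_level_zero_le_dSend u (ofCompacts K)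
  rw [level_ofCompacts] at h0
  obtain ⟨-, h2⟩ := TopologicalSpace.NonemptyCompacts.dist_le_iff.1
    (le_refl (dSend u (ofCompacts K)))
  refine TopologicalSpace.NonemptyCompacts.dist_le_iff.2 ⟨fun x hx => ?_, fun y hy => ?_⟩
  · exact (TopologicalSpace.NonemptyCompacts.dist_le_iff.1 h0).1 x
      (u.level_anti unitInterval.nonneg' hx)
  · obtain ⟨⟨x, β⟩, hx, hxy⟩ := h2 (y, 1)
      ((mem_level_iff_mem_sendograph _ y 1).1 (by rwa [level_ofCompacts]))
    have hβ : |(β : ℝ) - 1| ≤ dSend u (ofCompacts K) := (le_max_right _ _).trans hxy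
    have hαβ : α ≤ β := by
      have := (abs_le.1 hβ).1
      exact Subtype.coe_le_coe.1 (by linarith)
    exact ⟨x, u.level_anti hαβ ((mem_level_iff_mem_sendograph u x β).2 hx),
      (le_max_left _ _).trans hxy⟩

/-- A point of a sendograph can be lowered to height at most `1 - r` before being matched; this
costs at most `r ≤ c` vertically, and the product metric is a maximum, so the costs do not add. -/
theorem dSend_le_of_forall_level {u v : NormalFuzzySet X} {r c : ℝ} (hr : 0 < r) (hr1 : r ≤ 1)
    (hrc : r ≤ c) (h : ∀ α : unitInterval, (α : ℝ) ≤ 1 - r → dist (u.level α) (v.level α) ≤ c) :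
    dSend u v ≤ c := by
  have hcut : ∀ α : unitInterval, ∃ β ≤ α, (β : ℝ) ≤ 1 - r ∧ |(α : ℝ) - β| ≤ c := by
    intro α
    refine ⟨min α ⟨1 - r, by linarith, by linarith⟩, min_le_left _ _,
      min_le_right (α := unitInterval) _ _, ?_⟩
    rcases le_total α ⟨1 - r, by linarith, by linarith⟩ with hα | hα
    · rw [min_eq_left hα, sub_self, abs_zero]; linarith
    · rw [min_eq_right hα]
      have h1 : (1 - r : ℝ) ≤ α := hα
      have h2 : (α : ℝ) ≤ 1 := α.2.2
      exact abs_le.2 ⟨by change -c ≤ (α : ℝ) - (1 - r); linarith,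
        by change (α : ℝ) - (1 - r) ≤ c; linarith⟩
  refine TopologicalSpace.NonemptyCompacts.dist_le_iff.2 ⟨?_, ?_⟩
  · rintro ⟨x, α⟩ hx
    obtain ⟨β, hβα, hβ, hd⟩ := hcut α
    obtain ⟨y, hy, hxy⟩ := (TopologicalSpace.NonemptyCompacts.dist_le_iff.1 (h β hβ)).1 x
      (u.level_anti hβα ((mem_level_iff_mem_sendograph u x α).2 hx))
    exact ⟨(y, β), (mem_level_iff_mem_sendograph v y β).1 hy, max_le hxy hd⟩
  · rintro ⟨y, α⟩ hy
    obtain ⟨β, hβα, hβ, hd⟩ := hcut α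
    obtain ⟨x, hx, hxy⟩ := (TopologicalSpace.NonemptyCompacts.dist_le_iff.1 (h β hβ)).2 y
      (v.level_anti hβα ((mem_level_iff_mem_sendograph v y α).2 hy))
    exact ⟨(x, β), (mem_level_iff_mem_sendograph u x β).1 hx,
      max_le hxy (by rw [dist_comm]; exact hd)⟩

end NormalFuzzySet

end Fuzzy

/-! ### Conclusion for the three metrics -/

theorem mainTheorem4 {X : Type*} [MetricSpace X] [CompleteSpace X] (f : X → X) (hf : Continuous f)
    (h : CantorDenselyLiYorkeChaotic (zadehSup f hf) ∨
      CantorDenselyLiYorkeChaotic (zadehSkorokhod f hf) ∨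
      CantorDenselyLiYorkeChaotic (zadehSendograph f hf)) :
    CantorDenselyLiYorkeChaotic (hyperextension f hf) := by
  have hF : Continuous (hyperextension f hf) := hf.nonemptyCompacts_map
  rcases h with h | h | h
  · refine CantorDenselyLiYorkeChaotic.of_levels hF h NormalFuzzySet.ofCompacts
      NormalFuzzySet.level 0 (NormalFuzzySet.level_zadeh f hf)
      (fun u v => NormalFuzzySet.dist_level_le_dSup u v 0) fun r _ _ => ⟨univ, trivial, ?_, ?_⟩
    · exact fun u K hu α _ => NormalFuzzySet.dist_level_lt_of_dSup_lt hu α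
    · exact fun u v c _ huv => ciSup_le fun α => huv α trivial
  · refine CantorDenselyLiYorkeChaotic.of_levels hF h NormalFuzzySet.ofCompacts
      NormalFuzzySet.level 0 (NormalFuzzySet.level_zadeh f hf)
      NormalFuzzySet.dist_level_zero_le_dSkorokhod fun r hr _ => ⟨univ, trivial, ?_, ?_⟩
    · exact fun u K hu α _ => NormalFuzzySet.dist_level_lt_of_dSkorokhod_lt hu α
    · exact fun u v c hrc huv => NormalFuzzySet.dSkorokhod_le_of_dSup_le (hr.trans_le hrc)
        (ciSup_le fun α => huv α trivial)
  · refine CantorDenselyLiYorkeChaotic.of_levels hF h NormalFuzzySet.ofCompacts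
      NormalFuzzySet.level 0 (NormalFuzzySet.level_zadeh f hf)
      NormalFuzzySet.dist_level_zero_le_dSend fun r hr hr1 =>
        ⟨{α | (α : ℝ) ≤ 1 - r}, ?_, ?_, ?_⟩
    -- The base level `0` lies in the truncated range because `r ≤ 1`.
    · change (0 : ℝ) ≤ 1 - r
      linarith
    · exact fun u K hu α hα => NormalFuzzySet.dist_level_lt_of_dSend_lt hu hα
    · exact fun u v c hrc huv => NormalFuzzySet.dSend_le_of_forall_level hr hr1 hrc huv
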